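/- Let $n\ge 3$ be an integer and let $\sigma$ be a real constant. A mesh $\mathcal T$ of $[0,1]$ consists of nodes $0=x_0<x_1<\dots<x_N=1$; its size is $h=\max_{0\le i<N}(x_{i+1}-x_i)$, and it is uniform with constant $\sigma$ if $h/(x_{i+1}-x_i)\le\sigma$ for every $i$. Let $V_h$ be the space of continuous functions on $[0,1]$ that are affine on every interval $[x_i,x_{i+1}]$, and define the radial discrete Hardy constant $$S^n_h=\min_{\substack{v\in V_h,\ v(1)=0\\ v\not\equiv 0}}\ \frac{\int_0^1 r^{n-1}|v'(r)|^2\,dr}{\int_0^1 r^{n-3}|v(r)|^2\,dr},\qquad S^n=\frac{(n-2)^2}{4}.$$ Then, for all meshes of sufficiently small size $h$ that are uniform with constant $\sigma$, the minimum defining $S^n_h$ is attained and $$S^n+\frac{\pi^2}{|\log h|^2}+o\!\left(\frac1{|\log h|^2}\right)\ \le\ S^n_h\ \le\ S^n+\frac{(n+1)^2\pi^2}{4|\log h|^2}+o\!\left(\frac1{|\log h|^2}\right)\qquad (h\to0^+),$$ where the $o(\cdot)$ terms are functions of $h$ that depend only on $n$ and $\sigma$, as does the smallness threshold for $h$. 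-/

import Mathlib

open Filter Topology Asymptotics

/-- A triangulation (mesh) of `[0,1]`, given by its nodes `0 = x₀ < x₁ < ⋯ < x_N = 1`;
the elements are the intervals `[xᵢ, xᵢ₊₁]`. -/
structure Mesh where
  N : ℕ
  x : Fin (N + 1) → ℝ
  strictMono : StrictMono x
  x_first : x 0 = 0
  x_last : x (Fin.last N) = 1

namespace Mesh

/-- The diameter `xᵢ₊₁ - xᵢ` of the `i`-th element. -/
def diam (M : Mesh) (i : Fin M.N) : ℝ := M.x i.succ - M.x i.castSucc

/-- The mesh size `h`, the largest diameter of an element. -/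
noncomputable def size (M : Mesh) : ℝ := ⨆ i : Fin M.N, M.diam i

/-- Uniformity of the mesh with constant `σ`: the ratios `h / h_T` are bounded by `σ`. -/
def IsUniform (M : Mesh) (σ : ℝ) : Prop := ∀ i : Fin M.N, M.size / M.diam i ≤ σ

/-- The finite element space `V_h`: continuous functions on `[0,1]` that are affine on each element.
(Values outside `[0,1]` are irrelevant.) -/
def space (M : Mesh) : Set (ℝ → ℝ) :=
  {v | ContinuousOn v (Set.Icc 0 1) ∧
    ∀ i : Fin M.N, ∃ a b : ℝ, ∀ r ∈ Set.Icc (M.x i.castSucc) (M.x i.succ), v r = a + b * r}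

end Mesh

/-- The radial Hardy quotient `∫₀¹ r^(n-1) |v'|² dr / ∫₀¹ r^(n-3) |v|² dr`, used for `3 ≤ n`. -/
noncomputable def hardyQuotient (n : ℕ) (v : ℝ → ℝ) : ℝ :=
  (∫ r in (0 : ℝ)..1, r ^ (n - 1) * |deriv v r| ^ 2) /
    (∫ r in (0 : ℝ)..1, r ^ (n - 3) * |v r| ^ 2)

/-- The values of the Hardy quotient on the functions `v ∈ V_h` with `v(1) = 0` that do not vanish
identically on `[0,1]`. -/
def discreteHardyValues (n : ℕ) (M : Mesh) : Set ℝ :=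
  {q | ∃ v ∈ M.space, v 1 = 0 ∧ (∃ r ∈ Set.Icc (0 : ℝ) 1, v r ≠ 0) ∧ q = hardyQuotient n v}

/-- The radial discrete Hardy constant `S^n_h` of the mesh. -/
noncomputable def discreteHardyConst (n : ℕ) (M : Mesh) : ℝ := sInf (discreteHardyValues n M)

/-- The Hardy constant `S^n = (n-2)²/4`. -/
noncomputable def hardyConst (n : ℕ) : ℝ := ((n : ℝ) - 2) ^ 2 / 4

/-! Write `n = m + 3`, `D = n - 2`. A function of `V_h` is determined by its nodal values, so the
quotient is a ratio of two continuous functions, homogeneous of degree two, on a finite-dimensional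
space. Compactness of the unit sphere gives the minimum.

Both bounds rest on the solutions `φ = r^(-D/2) sin(μ (c - log r))` of `(r^(n-1) φ')' = -(S^n + μ²)
r^(n-3) φ`: positivity on an interval of logarithmic length `L` allows `μ` up to about `π / L`.

Lower bound. The mesh does not resolve scales below its first positive node `x₁`. On `[x₁, 1]`, with
`G = r^(n-1) φ' / φ`, Picone's identity writes `r^(n-1) v'² - (S^n + μ²) r^(n-3) v²` as `(G v²)'`
plus a nonnegative square (`riccati_le_integral`). On `[0, x₁]` the function is affine, and the form
including the boundary term at `x₁` is a two-variable quadratic form. It is coercive at `μ = 0`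
(`affine_form_coercive`), with enough margin for a small `μ` and a fixed large `c`
(`riccati_le_integral_zero`). Summing over elements gives `S^n + π² / (2c - log x₁)²`, and
uniformity gives `-log x₁ ≤ |log h| + |log σ|`.

Upper bound. On `[ρ, 1]` the profile `r^(-D/2) sin(ω log r)` with `ω = π / |log ρ|` vanishes at both
ends and has quotient exactly `S^n + ω²`. Its interpolant, extended by zero, is the test function.
If `ρ` is a node between `h^(3/5)` and `h^(1/2)`, interpolation costs a relative error
`O(h^(1/10))`, negligible against `1 / |log h|²`, while `ω² ≤ 4π² / |log h|²`. This is at most the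
stated term because `16 ≤ (n+1)²`. -/

/-! ### Nodal values and elementwise sums -/

namespace Mesh

/-- The nodes of a mesh indexed by natural numbers, constant after the last one. -/
def node (M : Mesh) (i : ℕ) : ℝ := M.x ⟨min i M.N, by omega⟩

lemma node_eq (M : Mesh) (i : Fin (M.N + 1)) : M.node i = M.x i := by
  unfold node
  congr 1
  ext
  simp
  omega

lemma node_zero (M : Mesh) : M.node 0 = 0 := by
  rw [← M.x_first, ← M.node_eq]
  rfl

lemma node_N (M : Mesh) : M.node M.N = 1 := by
  rw [← M.x_last, ← M.node_eq]
  rfl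

lemma node_mono (M : Mesh) : Monotone M.node := by
  intro i j hij
  unfold node
  apply M.strictMono.monotone
  simp only [Fin.mk_le_mk]
  omega

lemma node_lt (M : Mesh) {i j : ℕ} (hij : i < j) (hj : j ≤ M.N) : M.node i < M.node j := by
  unfold node
  apply M.strictMono
  simp only [Fin.mk_lt_mk]
  omega

lemma N_pos (M : Mesh) : 0 < M.N := by
  rcases Nat.eq_zero_or_pos M.N with h | h
  · have h0 := M.node_zero
    have h1 := M.node_N
    rw [h, h0] at h1
    norm_num at h1
  · exact h

lemma node_nonneg (M : Mesh) (i : ℕ) : 0 ≤ M.node i := by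
  rw [← M.node_zero]
  exact M.node_mono (Nat.zero_le i)

lemma node_le_one (M : Mesh) {i : ℕ} (hi : i ≤ M.N) : M.node i ≤ 1 := by
  rw [← M.node_N]
  exact M.node_mono hi

lemma node_pos (M : Mesh) {i : ℕ} (h0 : 0 < i) (hi : i ≤ M.N) : 0 < M.node i := by
  rw [← M.node_zero]
  exact M.node_lt h0 hi

lemma diam_eq (M : Mesh) {i : ℕ} (hi : i < M.N) :
    M.diam ⟨i, hi⟩ = M.node (i + 1) - M.node i := by
  unfold diam
  rw [← M.node_eq, ← M.node_eq]
  rfl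

lemma sub_le_size (M : Mesh) {i : ℕ} (hi : i < M.N) :
    M.node (i + 1) - M.node i ≤ M.size := by
  rw [← M.diam_eq hi]
  exact le_ciSup (Set.finite_range M.diam).bddAbove _

lemma size_pos (M : Mesh) : 0 < M.size :=
  lt_of_lt_of_le (sub_pos.2 (M.node_lt (Nat.lt_succ_self 0) M.N_pos)) (M.sub_le_size M.N_pos)

lemma mem_space_iff (M : Mesh) (v : ℝ → ℝ) :
    v ∈ M.space ↔ ContinuousOn v (Set.Icc 0 1) ∧ ∀ i < M.N, ∃ a b : ℝ,
      ∀ r ∈ Set.Icc (M.node i) (M.node (i + 1)), v r = a + b * r := by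
  refine and_congr Iff.rfl ⟨fun h i hi => ?_, fun h i => ?_⟩
  · obtain ⟨a, b, hab⟩ := h ⟨i, hi⟩
    refine ⟨a, b, ?_⟩
    rw [← M.node_eq, ← M.node_eq] at hab
    exact hab
  · obtain ⟨a, b, hab⟩ := h i i.2
    refine ⟨a, b, ?_⟩
    rw [← M.node_eq, ← M.node_eq]
    exact hab

/-- The Dirichlet part of the Hardy quotient of a piecewise affine function is a sum over
elements. -/
lemma integral_deriv_sq (M : Mesh) (p : ℕ) {v : ℝ → ℝ} {a b : ℕ → ℝ}
    (hv : ∀ i < M.N, ∀ r ∈ Set.Icc (M.node i) (M.node (i + 1)), v r = a i + b i * r) :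
    ∫ r in (0 : ℝ)..1, r ^ p * |deriv v r| ^ 2 =
      ∑ i ∈ Finset.range M.N, ∫ r in M.node i..M.node (i + 1), r ^ p * b i ^ 2 := by
  -- Only open elements: at a kink `deriv v` has the default value `0`, and the nodes do not affect
  -- the integral.
  have key : ∀ i < M.N, Set.EqOn (fun r => r ^ p * b i ^ 2) (fun r => r ^ p * |deriv v r| ^ 2)
      (Set.Ioo (M.node i) (M.node (i + 1))) := by
    intro i hi r hr
    have : deriv v r = b i := by
      have h1 : v =ᶠ[𝓝 r] fun r => a i + b i * r := by
        filter_upwards [Ioo_mem_nhds hr.1 hr.2] with s hs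
        exact hv i hi s (Set.Ioo_subset_Icc_self hs)
      rw [h1.deriv_eq]
      simp
    simp [this]
  have hle : ∀ i < M.N, M.node i ≤ M.node (i + 1) := fun i _ => M.node_mono (Nat.le_succ i)
  rw [← M.node_zero, ← M.node_N, ← intervalIntegral.sum_integral_adjacent_intervals]
  · refine Finset.sum_congr rfl fun i hi => ?_
    have hi := Finset.mem_range.1 hi
    rw [intervalIntegral.integral_of_le (hle i hi), intervalIntegral.integral_of_le (hle i hi),
      MeasureTheory.integral_Ioc_eq_integral_Ioo, MeasureTheory.integral_Ioc_eq_integral_Ioo]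
    exact (MeasureTheory.setIntegral_congr_fun measurableSet_Ioo (key i hi)).symm
  · intro i hi
    have hc : IntervalIntegrable (fun r : ℝ => r ^ p * b i ^ 2) MeasureTheory.volume
      (M.node i) (M.node (i + 1)) := (by fun_prop : Continuous _).intervalIntegrable _ _
    rw [intervalIntegrable_iff_integrableOn_Ioo_of_le (hle i hi)] at hc ⊢
    exact hc.congr_fun (key i hi) measurableSet_Ioo

/-- The mass part of the Hardy quotient of a piecewise affine function is a sum over elements. -/
lemma integral_sq (M : Mesh) (p : ℕ) {v : ℝ → ℝ} {a b : ℕ → ℝ}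
    (hv : ∀ i < M.N, ∀ r ∈ Set.Icc (M.node i) (M.node (i + 1)), v r = a i + b i * r) :
    ∫ r in (0 : ℝ)..1, r ^ p * |v r| ^ 2 =
      ∑ i ∈ Finset.range M.N, ∫ r in M.node i..M.node (i + 1), r ^ p * (a i + b i * r) ^ 2 := by
  have hle : ∀ i < M.N, M.node i ≤ M.node (i + 1) := fun i _ => M.node_mono (Nat.le_succ i)
  have key : ∀ i < M.N, Set.EqOn (fun r => r ^ p * (a i + b i * r) ^ 2)
      (fun r => r ^ p * |v r| ^ 2) (Set.uIcc (M.node i) (M.node (i + 1))) := by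
    intro i hi r hr
    rw [Set.uIcc_of_le (hle i hi)] at hr
    simp only [hv i hi r hr, sq_abs]
  rw [← M.node_zero, ← M.node_N, ← intervalIntegral.sum_integral_adjacent_intervals]
  · exact Finset.sum_congr rfl fun i hi =>
      (intervalIntegral.integral_congr (key i (Finset.mem_range.1 hi))).symm
  · intro i hi
    have hc : IntervalIntegrable (fun r : ℝ => r ^ p * (a i + b i * r) ^ 2) MeasureTheory.volume
      (M.node i) (M.node (i + 1)) := (by fun_prop : Continuous _).intervalIntegrable _ _
    exact hc.congr ((key i hi).mono Set.uIoc_subset_uIcc)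

/-- Slope on the `i`-th element of the piecewise affine function with nodal values `u`. -/
noncomputable def slope (M : Mesh) (u : ℕ → ℝ) (i : ℕ) : ℝ :=
  (u (i + 1) - u i) / (M.node (i + 1) - M.node i)

/-- Intercept on the `i`-th element of the piecewise affine function with nodal values `u`. -/
noncomputable def icpt (M : Mesh) (u : ℕ → ℝ) (i : ℕ) : ℝ := u i - M.slope u i * M.node i

/-- The piecewise affine function with nodal values `u`. -/
noncomputable def interp (M : Mesh) (u : ℕ → ℝ) (r : ℝ) : ℝ :=
  u 0 + ∑ i ∈ Finset.range M.N,
    M.slope u i * (max (M.node i) (min r (M.node (i + 1))) - M.node i)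

lemma interp_eq (M : Mesh) (u : ℕ → ℝ) {j : ℕ} (hj : j < M.N) {r : ℝ}
    (hr : r ∈ Set.Icc (M.node j) (M.node (j + 1))) :
    M.interp u r = M.icpt u j + M.slope u j * r := by
  -- Elements to the left of `r` contribute their whole increment and telescope; those to the right
  -- are clipped to length zero.
  have h1 : ∑ i ∈ Finset.range j,
      M.slope u i * (max (M.node i) (min r (M.node (i + 1))) - M.node i) = u j - u 0 := by
    rw [← Finset.sum_range_sub]
    refine Finset.sum_congr rfl fun i hi => ?_
    have hi := Finset.mem_range.1 hi
    have h2 : M.node (i + 1) ≤ r := le_trans (M.node_mono hi) hr.1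
    have h3 : M.node i < M.node (i + 1) := M.node_lt (Nat.lt_succ_self i) (by omega)
    rw [min_eq_right h2, max_eq_right h3.le, slope, div_mul_cancel₀ _ (by linarith)]
  have h2 : ∑ i ∈ Finset.Ico (j + 1) M.N,
      M.slope u i * (max (M.node i) (min r (M.node (i + 1))) - M.node i) = 0 := by
    refine Finset.sum_eq_zero fun i hi => ?_
    have hi := Finset.mem_Ico.1 hi
    have h2 : r ≤ M.node i := le_trans hr.2 (M.node_mono hi.1)
    rw [max_eq_left (le_trans (min_le_left _ _) h2)]
    ring
  rw [interp, ← Finset.sum_range_add_sum_Ico _ (Nat.succ_le_of_lt hj), h2,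
    Finset.sum_range_succ, h1, min_eq_left hr.2, max_eq_right hr.1, icpt]
  ring

lemma interp_mem_space (M : Mesh) (u : ℕ → ℝ) : M.interp u ∈ M.space := by
  rw [mem_space_iff]
  refine ⟨?_, fun i hi => ⟨_, _, fun r hr => M.interp_eq u hi hr⟩⟩
  unfold interp
  fun_prop

lemma interp_node (M : Mesh) (u : ℕ → ℝ) {j : ℕ} (hj : j ≤ M.N) :
    M.interp u (M.node j) = u j := by
  rcases hj.lt_or_eq with h | h
  · rw [M.interp_eq u h ⟨le_rfl, M.node_mono (Nat.le_succ j)⟩, icpt]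
    ring
  · obtain ⟨i, rfl⟩ : ∃ i, j = i + 1 := ⟨j - 1, by have := M.N_pos; omega⟩
    have h3 : M.node i < M.node (i + 1) := M.node_lt (Nat.lt_succ_self i) hj
    rw [M.interp_eq u (by omega : i < M.N) ⟨h3.le, le_rfl⟩, icpt, slope]
    have : M.node (i + 1) - M.node i ≠ 0 := by linarith
    field_simp
    ring

/-- Every function of the finite element space agrees with the interpolant of its nodal values. -/
lemma eq_icpt_add_slope (M : Mesh) {v : ℝ → ℝ} (hv : v ∈ M.space) {u : ℕ → ℝ}
    (hu : ∀ i ≤ M.N, u i = v (M.node i)) {i : ℕ} (hi : i < M.N) {r : ℝ}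
    (hr : r ∈ Set.Icc (M.node i) (M.node (i + 1))) :
    v r = M.icpt u i + M.slope u i * r := by
  obtain ⟨a, b, hab⟩ := ((M.mem_space_iff v).1 hv).2 i hi
  have h3 : M.node i < M.node (i + 1) := M.node_lt (Nat.lt_succ_self i) hi
  have h4 : M.node (i + 1) - M.node i ≠ 0 := by linarith
  rw [icpt, slope, hu i hi.le, hu (i + 1) hi, hab r hr, hab _ ⟨h3.le, le_rfl⟩,
    hab _ ⟨le_rfl, h3.le⟩]
  field_simp
  ring

/-- Dirichlet energy as a function of nodal values. -/
noncomputable def energy (M : Mesh) (p : ℕ) (u : ℕ → ℝ) : ℝ :=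
  ∑ i ∈ Finset.range M.N, ∫ r in M.node i..M.node (i + 1), r ^ p * M.slope u i ^ 2

/-- Weighted mass as a function of nodal values. -/
noncomputable def mass (M : Mesh) (p : ℕ) (u : ℕ → ℝ) : ℝ :=
  ∑ i ∈ Finset.range M.N,
    ∫ r in M.node i..M.node (i + 1), r ^ p * (M.icpt u i + M.slope u i * r) ^ 2

lemma hardyQuotient_eq (M : Mesh) (n : ℕ) {v : ℝ → ℝ} (hv : v ∈ M.space) {u : ℕ → ℝ}
    (hu : ∀ i ≤ M.N, u i = v (M.node i)) :
    hardyQuotient n v = M.energy (n - 1) u / M.mass (n - 3) u := by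
  have h : ∀ i < M.N, ∀ r ∈ Set.Icc (M.node i) (M.node (i + 1)),
    v r = M.icpt u i + M.slope u i * r := fun i hi r hr => M.eq_icpt_add_slope hv hu hi hr
  rw [hardyQuotient, M.integral_deriv_sq _ h, M.integral_sq _ h]
  rfl

lemma hardyQuotient_interp (M : Mesh) (n : ℕ) (u : ℕ → ℝ) :
    hardyQuotient n (M.interp u) = M.energy (n - 1) u / M.mass (n - 3) u :=
  M.hardyQuotient_eq n (M.interp_mem_space u) fun _ hi => (M.interp_node u hi).symm

/-- The mass of nonzero nodal values is positive. -/
lemma mass_pos (M : Mesh) (p : ℕ) {u : ℕ → ℝ} {j : ℕ} (hj : j ≤ M.N) (hu : u j ≠ 0) :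
    0 < M.mass p u := by
  have h : ∀ i < M.N, ∀ r ∈ Set.Icc (M.node i) (M.node (i + 1)),
    M.interp u r = M.icpt u i + M.slope u i * r := fun i hi r hr => M.interp_eq u hi hr
  have hc : Continuous (M.interp u) := by unfold interp; fun_prop
  rw [mass, ← M.integral_sq p h]
  have hne : ∃ r ∈ Set.Ioc (0 : ℝ) 1, M.interp u r ≠ 0 := by
    -- The node `0` is special: the weight `r ^ p` may vanish there, so continuity supplies a nearby
    -- positive point.
    rcases Nat.eq_zero_or_pos j with rfl | hj0
    · have h0 : M.interp u 0 ≠ 0 := by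
        have h := M.interp_node u hj
        rw [M.node_zero] at h
        rwa [h]
      have h1 : ∀ᶠ r in 𝓝[>] (0 : ℝ), M.interp u r ≠ 0 :=
        (hc.continuousAt.eventually_ne h0).filter_mono nhdsWithin_le_nhds
      have h2 : ∀ᶠ r in 𝓝[>] (0 : ℝ), r ∈ Set.Ioc (0 : ℝ) 1 := Ioc_mem_nhdsGT one_pos
      obtain ⟨r, hr⟩ := (h2.and h1).exists
      exact ⟨r, hr⟩
    · exact ⟨M.node j, ⟨M.node_pos hj0 hj, M.node_le_one hj⟩, by rwa [M.interp_node u hj]⟩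
  obtain ⟨r, hr, hr'⟩ := hne
  refine intervalIntegral.integral_pos one_pos (by fun_prop) (fun s hs => ?_)
    ⟨r, ⟨hr.1.le, hr.2⟩, ?_⟩
  · have := hs.1
    positivity
  · have := hr.1
    positivity

end Mesh

/-! ### Attainment of the minimum -/

namespace Mesh

lemma exists_element (M : Mesh) {r : ℝ} (hr : r ∈ Set.Icc (0 : ℝ) 1) :
    ∃ i < M.N, r ∈ Set.Icc (M.node i) (M.node (i + 1)) := by
  classical
  have hex : ∃ j, r ≤ M.node j := ⟨M.N, by rw [M.node_N]; exact hr.2⟩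
  have hle : Nat.find hex ≤ M.N := Nat.find_min' hex (by rw [M.node_N]; exact hr.2)
  rcases Nat.eq_zero_or_pos (Nat.find hex) with h | h
  · have h1 := Nat.find_spec hex
    rw [h, M.node_zero] at h1
    refine ⟨0, M.N_pos, ?_, h1.trans (M.node_nonneg _)⟩
    rw [M.node_zero]
    exact hr.1
  · have h1 := Nat.find_min hex (Nat.sub_lt h one_pos)
    refine ⟨Nat.find hex - 1, by omega, (not_le.1 h1).le, ?_⟩
    rw [Nat.sub_add_cancel (by omega : 1 ≤ Nat.find hex)]
    exact Nat.find_spec hex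

/-- A function of the finite element space vanishing at `1` but not identically has a nonzero
value at a node other than the last one. -/
lemma exists_node_ne_zero (M : Mesh) {v : ℝ → ℝ} (hv : v ∈ M.space) (h1 : v 1 = 0)
    (hne : ∃ r ∈ Set.Icc (0 : ℝ) 1, v r ≠ 0) : ∃ j < M.N, v (M.node j) ≠ 0 := by
  by_contra! hcon
  have hz : ∀ i ≤ M.N, v (M.node i) = 0 := by
    intro i hi
    rcases hi.lt_or_eq with h | h
    · exact hcon i h
    · rw [h, M.node_N, h1]
  obtain ⟨r, hr, hr'⟩ := hne
  obtain ⟨i, hi, hri⟩ := M.exists_element hr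
  apply hr'
  rw [M.eq_icpt_add_slope hv (u := fun _ => 0) (fun i hi => (hz i hi).symm) hi hri]
  simp [icpt, slope]

/-- Extension by zero of nodal values at all nodes but the last one. -/
def zeroExt (M : Mesh) (w : Fin M.N → ℝ) (i : ℕ) : ℝ := if h : i < M.N then w ⟨i, h⟩ else 0

lemma continuous_zeroExt (M : Mesh) (i : ℕ) : Continuous fun w => M.zeroExt w i := by
  unfold zeroExt
  split_ifs <;> fun_prop

lemma continuous_slope (M : Mesh) (i : ℕ) : Continuous fun w => M.slope (M.zeroExt w) i := by
  have h1 := M.continuous_zeroExt i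
  have h2 := M.continuous_zeroExt (i + 1)
  unfold slope
  fun_prop

lemma continuous_icpt (M : Mesh) (i : ℕ) : Continuous fun w => M.icpt (M.zeroExt w) i := by
  have h1 := M.continuous_zeroExt i
  have h2 := M.continuous_slope i
  unfold icpt
  fun_prop

lemma continuous_energy (M : Mesh) (p : ℕ) : Continuous fun w => M.energy p (M.zeroExt w) := by
  unfold energy
  refine continuous_finsetSum _ fun i _ =>
    intervalIntegral.continuous_parametric_intervalIntegral_of_continuous' ?_ _ _
  have h2 := (M.continuous_slope i).comp (continuous_fst (Y := ℝ))
  exact (continuous_snd.pow p).mul (h2.pow 2)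

lemma continuous_mass (M : Mesh) (p : ℕ) : Continuous fun w => M.mass p (M.zeroExt w) := by
  unfold mass
  refine continuous_finsetSum _ fun i _ =>
    intervalIntegral.continuous_parametric_intervalIntegral_of_continuous' ?_ _ _
  have h1 := (M.continuous_icpt i).comp (continuous_fst (Y := ℝ))
  have h2 := (M.continuous_slope i).comp (continuous_fst (Y := ℝ))
  exact (continuous_snd.pow p).mul ((h1.add (h2.mul continuous_snd)).pow 2)

lemma energy_smul (M : Mesh) (p : ℕ) (t : ℝ) (u : ℕ → ℝ) :
    M.energy p (t • u) = t ^ 2 * M.energy p u := by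
  unfold energy
  rw [Finset.mul_sum]
  refine Finset.sum_congr rfl fun i _ => ?_
  rw [← intervalIntegral.integral_const_mul]
  congr 1
  ext r
  simp only [slope, Pi.smul_apply, smul_eq_mul]
  ring

lemma mass_smul (M : Mesh) (p : ℕ) (t : ℝ) (u : ℕ → ℝ) :
    M.mass p (t • u) = t ^ 2 * M.mass p u := by
  unfold mass
  rw [Finset.mul_sum]
  refine Finset.sum_congr rfl fun i _ => ?_
  rw [← intervalIntegral.integral_const_mul]
  congr 1
  ext r
  simp only [icpt, slope, Pi.smul_apply, smul_eq_mul]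
  ring

lemma zeroExt_smul (M : Mesh) (t : ℝ) (w : Fin M.N → ℝ) :
    M.zeroExt (t • w) = t • M.zeroExt w := by
  ext i
  simp only [zeroExt, Pi.smul_apply, smul_eq_mul]
  split_ifs <;> simp

lemma mass_zeroExt_pos (M : Mesh) (p : ℕ) {w : Fin M.N → ℝ} (hw : w ≠ 0) :
    0 < M.mass p (M.zeroExt w) := by
  obtain ⟨i, hi⟩ := Function.ne_iff.1 hw
  refine M.mass_pos p i.2.le ?_
  simpa [zeroExt] using hi

lemma interp_mem_values (M : Mesh) (n : ℕ) {u : ℕ → ℝ} (hN : u M.N = 0) {j : ℕ}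
    (hj : j ≤ M.N) (hu : u j ≠ 0) :
    M.energy (n - 1) u / M.mass (n - 3) u ∈ discreteHardyValues n M := by
  refine ⟨M.interp u, M.interp_mem_space u, ?_, ⟨M.node j, ⟨M.node_nonneg j, M.node_le_one hj⟩, ?_⟩,
    (M.hardyQuotient_interp n u).symm⟩
  · have := M.interp_node u le_rfl
    rwa [M.node_N, hN] at this
  · rwa [M.interp_node u hj]

/-- The minimum defining the discrete Hardy constant is attained. -/
lemma exists_isLeast_values (M : Mesh) (n : ℕ) : ∃ q, IsLeast (discreteHardyValues n M) q := by
  have : Nonempty (Fin M.N) := ⟨⟨0, M.N_pos⟩⟩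
  have hne0 : ∀ w ∈ Metric.sphere (0 : Fin M.N → ℝ) 1, w ≠ 0 := by
    rintro w hw rfl
    simp at hw
  have hcont : ContinuousOn
      (fun w => M.energy (n - 1) (M.zeroExt w) / M.mass (n - 3) (M.zeroExt w))
      (Metric.sphere (0 : Fin M.N → ℝ) 1) :=
    (M.continuous_energy _).continuousOn.div (M.continuous_mass _).continuousOn
      fun w hw => (M.mass_zeroExt_pos _ (hne0 w hw)).ne'
  -- The quotient is homogeneous of degree zero in the nodal values, so the compact unit sphere
  -- carries all of its values.
  obtain ⟨w, hw, hmin⟩ := (isCompact_sphere (0 : Fin M.N → ℝ) 1).exists_isMinOn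
    (NormedSpace.sphere_nonempty.2 zero_le_one) hcont
  refine ⟨M.energy (n - 1) (M.zeroExt w) / M.mass (n - 3) (M.zeroExt w), ?_, ?_⟩
  · obtain ⟨i, hi⟩ := Function.ne_iff.1 (hne0 w hw)
    exact M.interp_mem_values n (by simp [zeroExt]) i.2.le (by simpa [zeroExt] using hi)
  · rintro q ⟨v, hv, hv1, hvne, rfl⟩
    obtain ⟨j, hj, hvj⟩ := M.exists_node_ne_zero hv hv1 hvne
    set z : Fin M.N → ℝ := fun i => v (M.node i) with hz
    have hzne : z ≠ 0 := fun h => hvj (by simpa [hz] using congrFun h ⟨j, hj⟩)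
    have hnz : ‖z‖ ≠ 0 := norm_ne_zero_iff.2 hzne
    rw [M.hardyQuotient_eq n hv (u := M.zeroExt z)]
    · have hs : ‖z‖⁻¹ • z ∈ Metric.sphere (0 : Fin M.N → ℝ) 1 := by
        simp [norm_smul, hnz]
      have := hmin hs
      simp only [Set.mem_ofPred_eq] at this
      rw [zeroExt_smul, energy_smul, mass_smul, mul_div_mul_left] at this
      · exact this
      · exact pow_ne_zero 2 (inv_ne_zero hnz)
    · intro i hi
      rcases hi.lt_or_eq with h | h
      · simp [zeroExt, h, hz]
      · rw [h, M.node_N, hv1]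
        simp [zeroExt]

lemma isLeast_discreteHardyConst (M : Mesh) (n : ℕ) :
    IsLeast (discreteHardyValues n M) (discreteHardyConst n M) := by
  obtain ⟨q, hq⟩ := M.exists_isLeast_values n
  rw [discreteHardyConst, hq.csInf_eq]
  exact hq

end Mesh

/-! ### Lower bound: Riccati equation and local inequalities -/

/-- The solution `r ^ (n - 1) φ' / φ`, `n = m + 3`, of the Riccati equation of the Hardy operator
for `φ = r ^ (-(n - 2) / 2) * sin (μ * (c - log r))`. -/
noncomputable def riccati (m : ℕ) (μ c r : ℝ) : ℝ :=
  -r ^ (m + 1) * (((m : ℝ) + 1) / 2 +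
    μ * (Real.cos (μ * (c - Real.log r)) / Real.sin (μ * (c - Real.log r))))

/-- Since `(r^(n-1) φ')' = -λ r^(n-3) φ` with `λ = S^n + μ²`, the quotient rule for `G = r^(n-1) φ'
/ φ` gives `G' = -λ r^(n-3) - G² / r^(n-1)`. -/
lemma hasDerivAt_riccati (m : ℕ) (μ c : ℝ) {r : ℝ} (hr : 0 < r)
    (hs : Real.sin (μ * (c - Real.log r)) ≠ 0) :
    HasDerivAt (riccati m μ c)
      (-((((m : ℝ) + 1) / 2) ^ 2 + μ ^ 2) * r ^ m - riccati m μ c r ^ 2 / r ^ (m + 2)) r := by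
  have h1 : HasDerivAt (fun r => μ * (c - Real.log r)) (μ * (-r⁻¹)) r :=
    ((Real.hasDerivAt_log hr.ne').const_sub c).const_mul μ
  have h2 := ((h1.cos.div h1.sin hs).const_mul μ).const_add (((m : ℝ) + 1) / 2)
  have h3 := (hasDerivAt_pow (m + 1) r).neg.mul h2
  refine h3.congr_deriv ?_
  simp only [riccati, Pi.neg_apply, Pi.div_apply]
  generalize Real.sin (μ * (c - Real.log r)) = S at *
  generalize Real.cos (μ * (c - Real.log r)) = C at *
  push_cast
  field_simp
  ring

/-- Local Hardy inequality with remainder on an interval away from the origin. -/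
lemma riccati_le_integral (m : ℕ) (μ c a b : ℝ) {p q : ℝ} (hp : 0 < p) (hpq : p ≤ q)
    (hs : ∀ r ∈ Set.Icc p q, 0 < Real.sin (μ * (c - Real.log r))) :
    riccati m μ c q * (a + b * q) ^ 2 - riccati m μ c p * (a + b * p) ^ 2 ≤
      (∫ r in p..q, r ^ (m + 2) * b ^ 2) -
      ((((m : ℝ) + 1) / 2) ^ 2 + μ ^ 2) * ∫ r in p..q, r ^ m * (a + b * r) ^ 2 := by
  have hpos : ∀ r ∈ Set.Icc p q, 0 < r := fun r hr => hp.trans_le hr.1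
  have hG : ∀ r ∈ Set.Icc p q, HasDerivAt (riccati m μ c) _ r := fun r hr =>
    hasDerivAt_riccati m μ c (hpos r hr) (hs r hr).ne'
  have hD : ∀ r ∈ Set.Icc p q, HasDerivAt (fun r => riccati m μ c r * (a + b * r) ^ 2)
      ((-((((m : ℝ) + 1) / 2) ^ 2 + μ ^ 2) * r ^ m - riccati m μ c r ^ 2 / r ^ (m + 2))
        * (a + b * r) ^ 2 + riccati m μ c r * (2 * (a + b * r) * b)) r := by
    intro r hr
    have h1 : HasDerivAt (fun r => (a + b * r) ^ 2) (2 * (a + b * r) * b) r := by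
      refine ((((hasDerivAt_id r).const_mul b).const_add a).pow 2).congr_deriv ?_
      simp
    exact (hG r hr).mul h1
  have hGc : ContinuousOn (riccati m μ c) (Set.Icc p q) := fun r hr =>
    (hG r hr).continuousAt.continuousWithinAt
  have hint : IntervalIntegrable (fun r =>
      (-((((m : ℝ) + 1) / 2) ^ 2 + μ ^ 2) * r ^ m - riccati m μ c r ^ 2 / r ^ (m + 2))
        * (a + b * r) ^ 2 + riccati m μ c r * (2 * (a + b * r) * b)) MeasureTheory.volume p q := by
    refine ContinuousOn.intervalIntegrable_of_Icc hpq ?_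
    have h0 : ContinuousOn (fun r => riccati m μ c r ^ 2 / r ^ (m + 2)) (Set.Icc p q) :=
      (hGc.pow 2).div (by fun_prop) fun r hr => pow_ne_zero _ (hpos r hr).ne'
    fun_prop
  have hftc := intervalIntegral.integral_eq_sub_of_hasDerivAt
    (fun r hr => hD r (by rwa [Set.uIcc_of_le hpq] at hr)) hint
  rw [← hftc, ← intervalIntegral.integral_const_mul, ← intervalIntegral.integral_sub
      ((by fun_prop : Continuous _).intervalIntegrable _ _)
      ((by fun_prop : Continuous _).intervalIntegrable _ _)]
  refine intervalIntegral.integral_mono_on hpq hint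
    ((by fun_prop : Continuous _).intervalIntegrable _ _) fun r hr => ?_
  have hr0 := hpos r hr
  -- Picone's identity: this square is exactly the difference between the integrand on the right and
  -- the derivative of `G v²`.
  have : 0 ≤ r ^ (m + 2) * (b - riccati m μ c r / r ^ (m + 2) * (a + b * r)) ^ 2 := by positivity
  have h2 : r ^ (m + 2) * (b - riccati m μ c r / r ^ (m + 2) * (a + b * r)) ^ 2 =
      r ^ (m + 2) * b ^ 2 - 2 * riccati m μ c r * b * (a + b * r)
        + riccati m μ c r ^ 2 / r ^ (m + 2) * (a + b * r) ^ 2 := by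
    field_simp
    ring
  rw [h2] at this
  linarith

/-- Coercivity of the Hardy form with boundary term on affine functions on `[0, 1]`. -/
lemma affine_form_coercive {D : ℝ} (hD : 1 ≤ D) (A B : ℝ) :
    3 / (32 * (D + 1)) * (A ^ 2 + B ^ 2) ≤
      B ^ 2 / (D + 2) - (D / 2) ^ 2 * (A ^ 2 / D + 2 * A * B / (D + 1) + B ^ 2 / (D + 2))
        + D / 2 * (A + B) ^ 2 := by
  have h1 : B ^ 2 / (D + 2) - (D / 2) ^ 2 * (A ^ 2 / D + 2 * A * B / (D + 1) + B ^ 2 / (D + 2))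
        + D / 2 * (A + B) ^ 2
      = (D * A ^ 2 + (D + 2) * B ^ 2 + 2 * A * B * (D * (D + 2) / (D + 1))) / 4 := by
    field_simp
    ring
  rw [h1]
  -- Up to the factor `1/4` the form has diagonal `D`, `D + 2` and off-diagonal entry `τ`. Its
  -- determinant `D(D+2) / (D+1)²` is at least `3/4` for `D ≥ 1`, and `δ` times its trace is `3/4`.
  -- Subtracting `δ` from the diagonal therefore keeps the determinant nonnegative.
  set δ := 3 / (8 * (D + 1)) with hδ
  set τ := D * (D + 2) / (D + 1) with hτ
  have e1 : 3 / (32 * (D + 1)) = δ / 4 := by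
    rw [hδ]
    field_simp
    ring
  have hδ1 : δ ≤ 3 / 16 := by
    rw [hδ, div_le_div_iff₀ (by linarith) (by norm_num)]
    linarith
  have hδ0 : 0 < δ := by positivity
  have hδD : δ * (2 * (D + 1)) = 3 / 4 := by
    rw [hδ]
    field_simp
    norm_num
  have hτ2 : τ ^ 2 ≤ D * (D + 2) - 3 / 4 := by
    rw [hτ, div_pow, div_le_iff₀ (by positivity)]
    nlinarith [mul_nonneg (by linarith : (0 : ℝ) ≤ D - 1) (by linarith : (0 : ℝ) ≤ D + 3)]
  have hdisc : τ ^ 2 ≤ (D - δ) * (D + 2 - δ) := by nlinarith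
  have hα : 0 < D - δ := by linarith
  have h2 : 0 ≤ (D - δ) * ((D - δ) * A ^ 2 + (D + 2 - δ) * B ^ 2 + 2 * A * B * τ) := by
    nlinarith [sq_nonneg ((D - δ) * A + τ * B), mul_nonneg (sub_nonneg.2 hdisc) (sq_nonneg B)]
  have h3 := nonneg_of_mul_nonneg_right h2 hα
  rw [e1]
  linarith

lemma integral_pow_mul_affine_sq (m : ℕ) (a b q : ℝ) :
    ∫ r in (0 : ℝ)..q, r ^ m * (a + b * r) ^ 2 =
      q ^ (m + 1) * (a ^ 2 / (m + 1) + 2 * a * (b * q) / (m + 2) + (b * q) ^ 2 / (m + 3)) := by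
  have : ∀ r : ℝ, r ^ m * (a + b * r) ^ 2 =
      a ^ 2 * r ^ m + 2 * a * b * r ^ (m + 1) + b ^ 2 * r ^ (m + 2) := fun r => by ring
  simp only [this]
  rw [intervalIntegral.integral_add, intervalIntegral.integral_add]
  · simp only [intervalIntegral.integral_const_mul, integral_pow]
    push_cast
    have h1 : (m : ℝ) + 1 ≠ 0 := by positivity
    have h2 : (m : ℝ) + 1 + 1 ≠ 0 := by positivity
    have h3 : (m : ℝ) + 2 + 1 ≠ 0 := by positivity
    have h2' : (m : ℝ) + 2 ≠ 0 := by positivity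
    have h3' : (m : ℝ) + 3 ≠ 0 := by positivity
    rw [show (m : ℝ) + 1 + 1 = m + 2 by ring, show (m : ℝ) + 2 + 1 = m + 3 by ring]
    field_simp
    simp
    ring
  all_goals exact (by fun_prop : Continuous _).intervalIntegrable _ _

/-- This is `x cot x ≤ 1` on `(0, π)`: below `π/2` because `x < tan x`, above because the cosine is
nonpositive. It bounds the cotangent in the boundary term by `1 / c`, whatever `μ` is. -/
lemma mul_cot_le {μ c : ℝ} (hμ : 0 < μ) (hc : 0 < c) (h : μ * c < Real.pi) :
    μ * (Real.cos (μ * c) / Real.sin (μ * c)) ≤ 1 / c := by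
  have hs : 0 < Real.sin (μ * c) := Real.sin_pos_of_pos_of_lt_pi (by positivity) h
  rw [mul_div_assoc', div_le_div_iff₀ hs hc]
  rcases lt_or_ge (μ * c) (Real.pi / 2) with h2 | h2
  · have hcos : 0 < Real.cos (μ * c) :=
      Real.cos_pos_of_mem_Ioo ⟨by nlinarith [Real.pi_pos, mul_pos hμ hc], h2⟩
    have := Real.lt_tan (mul_pos hμ hc) h2
    rw [Real.tan_eq_sin_div_cos, lt_div_iff₀ hcos] at this
    nlinarith
  · have hcos : Real.cos (μ * c) ≤ 0 :=
      Real.cos_nonpos_of_pi_div_two_le_of_le h2 (by linarith [Real.pi_pos])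
    nlinarith [mul_nonneg (mul_pos hμ hc).le (neg_nonneg.2 hcos)]

/-- Local Hardy inequality with remainder on the interval touching the origin. -/
lemma riccati_le_integral_zero (m : ℕ) {μ c q : ℝ} (a b : ℝ) (hμ : 0 < μ) (hc : 0 < c)
    (hq : 0 < q) (hq' : μ * (c - Real.log q) = Real.pi - μ * c) (hμc : μ * c < Real.pi)
    (hsmall : 2 * μ ^ 2 + 2 / c ≤ 3 / (32 * ((m : ℝ) + 2))) :
    riccati m μ c q * (a + b * q) ^ 2 ≤
      (∫ r in (0 : ℝ)..q, r ^ (m + 2) * b ^ 2) -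
      ((((m : ℝ) + 1) / 2) ^ 2 + μ ^ 2) * ∫ r in (0 : ℝ)..q, r ^ m * (a + b * r) ^ 2 := by
  have hcot := mul_cot_le hμ hc hμc
  have hE : ∫ r in (0 : ℝ)..q, r ^ (m + 2) * b ^ 2 = q ^ (m + 1) * ((b * q) ^ 2 / (m + 3)) := by
    rw [intervalIntegral.integral_mul_const, integral_pow]
    push_cast
    rw [show (m : ℝ) + 2 + 1 = m + 3 by ring]
    simp
    ring
  -- At `q` the phase is `π - μ c`, so the cotangent changes sign and the boundary coefficient is
  -- `-(D/2 - κ)`. The terms in `μ²` and `κ` are then perturbations of the coercive form.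
  rw [integral_pow_mul_affine_sq, hE, riccati, hq', Real.cos_pi_sub, Real.sin_pi_sub]
  set κ := μ * (Real.cos (μ * c) / Real.sin (μ * c)) with hκ
  rw [neg_div, mul_neg, ← hκ]
  have hco := affine_form_coercive (D := (m : ℝ) + 1) (by simp) a (b * q)
  rw [show (m : ℝ) + 1 + 1 = m + 2 by ring, show (m : ℝ) + 1 + 2 = m + 3 by ring] at hco
  have hqm : 0 < q ^ (m + 1) := by positivity
  generalize b * q = B at *
  have hM : a ^ 2 / (m + 1) + 2 * a * B / (m + 2) + B ^ 2 / (m + 3) ≤ 2 * (a ^ 2 + B ^ 2) := by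
    have h1 : a ^ 2 / ((m : ℝ) + 1) ≤ a ^ 2 :=
      div_le_self (sq_nonneg _) (by linarith [Nat.cast_nonneg (α := ℝ) m])
    have h3 : B ^ 2 / ((m : ℝ) + 3) ≤ B ^ 2 :=
      div_le_self (sq_nonneg _) (by linarith [Nat.cast_nonneg (α := ℝ) m])
    have h2 : 2 * a * B / ((m : ℝ) + 2) ≤ a ^ 2 + B ^ 2 :=
      (div_le_div_of_nonneg_right (by nlinarith [sq_nonneg (a - B)] : 2 * a * B ≤ a ^ 2 + B ^ 2)
        (by positivity)).trans
        (div_le_self (by positivity) (by linarith [Nat.cast_nonneg (α := ℝ) m]))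
    linarith
  have hK : κ * (a + B) ^ 2 ≤ 2 / c * (a ^ 2 + B ^ 2) := by
    calc κ * (a + B) ^ 2 ≤ 1 / c * (a + B) ^ 2 := by gcongr
      _ ≤ 1 / c * (2 * (a ^ 2 + B ^ 2)) := by
        gcongr
        nlinarith [sq_nonneg (a - B)]
      _ = _ := by ring
  have hμM := mul_le_mul_of_nonneg_left hM (sq_nonneg μ)
  have hfin := mul_le_mul_of_nonneg_right hsmall (by positivity : 0 ≤ a ^ 2 + B ^ 2)
  set Q := a ^ 2 / ((m : ℝ) + 1) + 2 * a * B / (m + 2) + B ^ 2 / (m + 3) with hQ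
  have : 0 ≤ B ^ 2 / (m + 3) - ((((m : ℝ) + 1) / 2) ^ 2 + μ ^ 2) * Q
      + (((m : ℝ) + 1) / 2 - κ) * (a + B) ^ 2 := by nlinarith
  nlinarith [mul_nonneg hqm.le this]

/-! ### Lower bound on the mesh -/

namespace Mesh

/-- Lower bound of the energy by the mass in terms of the first node. -/
lemma mass_mul_le_energy (M : Mesh) (m : ℕ) {μ c : ℝ} {u : ℕ → ℝ} (hu : u M.N = 0)
    (hμ : 0 < μ) (hc : 0 < c) (hμ' : μ * (2 * c - Real.log (M.node 1)) = Real.pi)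
    (hsmall : 2 * μ ^ 2 + 2 / c ≤ 3 / (32 * ((m : ℝ) + 2))) :
    ((((m : ℝ) + 1) / 2) ^ 2 + μ ^ 2) * M.mass m u ≤ M.energy (m + 2) u := by
  have hx0 : 0 < M.node 1 := M.node_pos one_pos M.N_pos
  have hlog : Real.log (M.node 1) ≤ 0 := Real.log_nonpos hx0.le (M.node_le_one M.N_pos)
  have hval : ∀ i < M.N, M.icpt u i + M.slope u i * M.node (i + 1) = u (i + 1) := by
    intro i hi
    rw [← M.interp_eq u hi ⟨M.node_mono (Nat.le_succ i), le_rfl⟩, M.interp_node u hi]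
  have hval' : ∀ i < M.N, M.icpt u i + M.slope u i * M.node i = u i := by
    intro i hi
    simp [icpt]
  -- By `hμ'` the phase runs from `μ c` at `r = 1` to `π - μ c` at the first positive node, staying
  -- inside `(0, π)`.
  have hs : ∀ r ∈ Set.Icc (M.node 1) 1, 0 < Real.sin (μ * (c - Real.log r)) := by
    intro r hr
    have h1 : Real.log r ≤ 0 := Real.log_nonpos (hx0.le.trans hr.1) hr.2
    have h2 : Real.log (M.node 1) ≤ Real.log r := Real.log_le_log hx0 hr.1
    refine Real.sin_pos_of_pos_of_lt_pi (mul_pos hμ (by linarith)) ?_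
    rw [← hμ']
    exact mul_lt_mul_of_pos_left (by linarith) hμ
  have main : ∀ j < M.N, riccati m μ c (M.node (j + 1)) * u (j + 1) ^ 2 ≤
      ∑ i ∈ Finset.range (j + 1), ((∫ r in M.node i..M.node (i + 1), r ^ (m + 2) * M.slope u i ^ 2)
        - ((((m : ℝ) + 1) / 2) ^ 2 + μ ^ 2) *
          ∫ r in M.node i..M.node (i + 1), r ^ m * (M.icpt u i + M.slope u i * r) ^ 2) := by
    intro j
    induction j with
    | zero =>
      intro hj
      have h := riccati_le_integral_zero m (M.icpt u 0) (M.slope u 0) hμ hc hx0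
        (by linarith) (by nlinarith) hsmall
      have h0 := hval 0 hj
      simp only [zero_add] at h0
      rw [h0] at h
      simpa [M.node_zero] using h
    | succ j ih =>
      intro hj
      have h1 : M.node 1 ≤ M.node (j + 1) := M.node_mono (by omega)
      have h := riccati_le_integral m μ c (M.icpt u (j + 1)) (M.slope u (j + 1))
        (hx0.trans_le h1) (M.node_mono (Nat.le_succ (j + 1)))
        fun r hr => hs r ⟨h1.trans hr.1, hr.2.trans (M.node_le_one hj)⟩
      rw [hval _ hj, hval' _ hj] at h
      rw [Finset.sum_range_succ]
      linarith [ih (by omega)]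
  -- The telescoped boundary term sits at the last node, where `u` vanishes.
  have h := main (M.N - 1) (Nat.sub_lt M.N_pos one_pos)
  rw [Nat.sub_add_cancel (by have := M.N_pos; omega : 1 ≤ M.N), hu, Finset.sum_sub_distrib, ← Finset.mul_sum] at h
  have h2 : 0 ≤ M.energy (m + 2) u - ((((m : ℝ) + 1) / 2) ^ 2 + μ ^ 2) * M.mass m u := by
    simpa [energy, mass] using h
  linarith

/-- Lower bound of the discrete Hardy constant in terms of the first node. -/
lemma le_discreteHardyConst (M : Mesh) (m : ℕ) :
    (((m : ℝ) + 1) / 2) ^ 2 +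
      Real.pi ^ 2 / (256 * ((m : ℝ) + 2) / 3 - Real.log (M.node 1)) ^ 2 ≤
      discreteHardyConst (m + 3) M := by
  obtain ⟨v, hv, hv1, hvne, hq⟩ := (M.isLeast_discreteHardyConst (m + 3)).1
  obtain ⟨j, hj, hvj⟩ := M.exists_node_ne_zero hv hv1 hvne
  have hlog : Real.log (M.node 1) ≤ 0 :=
    Real.log_nonpos (M.node_nonneg 1) (M.node_le_one M.N_pos)
  -- With this `c`, `2 / c` is half of the coercivity constant. The other half covers `2 μ²`,
  -- because `μ ≤ 2 / c ≤ 1 / 2`.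
  set c : ℝ := 128 * ((m : ℝ) + 2) / 3 with hc
  have hm : (0 : ℝ) ≤ m := Nat.cast_nonneg m
  have hc0 : 0 < c := by positivity
  have h2c : 256 * ((m : ℝ) + 2) / 3 = 2 * c := by
    rw [hc]
    ring
  set μ := Real.pi / (2 * c - Real.log (M.node 1)) with hμ
  have hden : 0 < 2 * c - Real.log (M.node 1) := by linarith
  have hμ0 : 0 < μ := div_pos Real.pi_pos hden
  have hμle : μ ≤ 2 / c := by
    rw [hμ, div_le_div_iff₀ hden hc0]
    nlinarith [Real.pi_le_four]
  have hcc : 2 / c = 3 / (64 * ((m : ℝ) + 2)) := by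
    rw [hc]
    field_simp
    norm_num
  have hsmall : 2 * μ ^ 2 + 2 / c ≤ 3 / (32 * ((m : ℝ) + 2)) := by
    have e : 3 / (32 * ((m : ℝ) + 2)) = 2 * (2 / c) := by
      rw [hcc]
      field_simp
      norm_num
    have h1 : 2 / c ≤ 1 / 2 := by
      rw [hcc, div_le_div_iff₀ (by positivity) (by norm_num)]
      linarith
    rw [e]
    nlinarith [sq_nonneg μ]
  rw [hq, M.hardyQuotient_eq (m + 3) hv (u := fun i => v (M.node i)) fun _ _ => rfl,
    le_div_iff₀ (M.mass_pos _ hj.le hvj), h2c, ← div_pow]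
  refine M.mass_mul_le_energy m (by rw [M.node_N, hv1]) hμ0 hc0 ?_ hsmall
  exact div_mul_cancel₀ _ hden.ne'

end Mesh

/-! ### Upper bound: the continuous test function -/

/-- The function `r ^ (-(n - 2) / 2) * sin (ω * log r)` with `n = m + 3`. -/
noncomputable def profile (m : ℕ) (ω r : ℝ) : ℝ :=
  Real.exp (-(((m : ℝ) + 1) / 2) * Real.log r) * Real.sin (ω * Real.log r)

/-- The derivative of `profile`. -/
noncomputable def profileDeriv (m : ℕ) (ω r : ℝ) : ℝ :=
  Real.exp (-(((m : ℝ) + 1) / 2) * Real.log r) / r *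
    (-(((m : ℝ) + 1) / 2) * Real.sin (ω * Real.log r) + ω * Real.cos (ω * Real.log r))

lemma hasDerivAt_profile (m : ℕ) (ω : ℝ) {r : ℝ} (hr : 0 < r) :
    HasDerivAt (profile m ω) (profileDeriv m ω r) r := by
  have h := Real.hasDerivAt_log hr.ne'
  refine ((h.const_mul (-(((m : ℝ) + 1) / 2))).exp.mul (h.const_mul ω).sin).congr_deriv ?_
  rw [profileDeriv]
  field_simp

lemma continuousOn_profileDeriv (m : ℕ) (ω : ℝ) {p q : ℝ} (hp : 0 < p) :
    ContinuousOn (profileDeriv m ω) (Set.Icc p q) := by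
  have h : ContinuousOn Real.log (Set.Icc p q) :=
    Real.continuousOn_log.mono fun r hr => (hp.trans_le hr.1).ne'
  have h2 : ∀ r ∈ Set.Icc p q, r ≠ 0 := fun r hr => (hp.trans_le hr.1).ne'
  unfold profileDeriv
  fun_prop (disch := assumption)

lemma exp_neg_mul_log_sq (m : ℕ) {r : ℝ} (hr : 0 < r) :
    Real.exp (-(((m : ℝ) + 1) / 2) * Real.log r) ^ 2 = (r ^ (m + 1))⁻¹ := by
  rw [← Real.exp_nat_mul, ← Real.exp_log (pow_pos hr (m + 1)), ← Real.exp_neg, Real.log_pow]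
  congr 1
  push_cast
  ring

lemma pow_mul_profile_sq (m : ℕ) (ω : ℝ) {r : ℝ} (hr : 0 < r) :
    r ^ m * profile m ω r ^ 2 = Real.sin (ω * Real.log r) ^ 2 / r := by
  rw [profile, mul_pow, exp_neg_mul_log_sq m hr]
  field_simp
  ring

lemma profileDeriv_sq (m : ℕ) (ω : ℝ) {r : ℝ} (hr : 0 < r) :
    profileDeriv m ω r ^ 2 = (-(((m : ℝ) + 1) / 2) * Real.sin (ω * Real.log r)
      + ω * Real.cos (ω * Real.log r)) ^ 2 / r ^ (m + 3) := by
  rw [profileDeriv, mul_pow, div_pow, exp_neg_mul_log_sq m hr]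
  field_simp
  ring

lemma abs_profileDeriv_le (m : ℕ) {ω : ℝ} (hω : 0 ≤ ω) {p r : ℝ} (hp : 0 < p) (hpr : p ≤ r) :
    |profileDeriv m ω r| ≤ Real.sqrt ((((m : ℝ) + 1) / 2 + ω) ^ 2 / p ^ (m + 3)) := by
  apply Real.le_sqrt_of_sq_le
  rw [sq_abs, profileDeriv_sq m ω (hp.trans_le hpr)]
  have h : |-(((m : ℝ) + 1) / 2) * Real.sin (ω * Real.log r) + ω * Real.cos (ω * Real.log r)|
      ≤ ((m : ℝ) + 1) / 2 + ω := by
    refine (abs_add_le _ _).trans ?_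
    rw [abs_mul, abs_mul, abs_neg, abs_of_nonneg hω, abs_of_nonneg (by positivity :
      (0 : ℝ) ≤ ((m : ℝ) + 1) / 2)]
    exact add_le_add (mul_le_of_le_one_right (by positivity) (Real.abs_sin_le_one _))
      (mul_le_of_le_one_right hω (Real.abs_cos_le_one _))
  have h2 := pow_le_pow_left₀ (abs_nonneg _) h 2
  rw [sq_abs] at h2
  gcongr

/-- In the variable `log r` the integrand is `sin²` over exactly half a period, whose mean is `1/2`.
-/
lemma integral_pow_mul_profile_sq (m : ℕ) {ω ρ : ℝ} (hω : 0 < ω) (hρ : 0 < ρ) (hρ1 : ρ ≤ 1)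
    (h : ω * Real.log ρ = -Real.pi) :
    ∫ r in ρ..1, r ^ m * profile m ω r ^ 2 = -Real.log ρ / 2 := by
  have hpos : ∀ r ∈ Set.uIcc ρ 1, 0 < r := fun r hr => by
    rw [Set.uIcc_of_le hρ1] at hr
    exact hρ.trans_le hr.1
  rw [intervalIntegral.integral_congr fun r hr => pow_mul_profile_sq m ω (hpos r hr)]
  have hd : ∀ r ∈ Set.uIcc ρ 1, HasDerivAt (fun r => Real.log r / 2 -
      Real.sin (ω * Real.log r) * Real.cos (ω * Real.log r) / (2 * ω))
      (Real.sin (ω * Real.log r) ^ 2 / r) r := by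
    intro r hr
    have hr0 := hpos r hr
    have hl := Real.hasDerivAt_log hr0.ne'
    have hl' := hl.const_mul ω
    refine ((hl.div_const 2).sub ((hl'.sin.mul hl'.cos).div_const (2 * ω))).congr_deriv ?_
    have hsc := Real.sin_sq_add_cos_sq (ω * Real.log r)
    field_simp
    linear_combination -hsc
  rw [intervalIntegral.integral_eq_sub_of_hasDerivAt hd]
  · simp only [h, Real.log_one, mul_zero, Real.sin_zero, Real.sin_neg, Real.sin_pi]
    ring
  · refine ContinuousOn.intervalIntegrable ?_
    have h1 : ContinuousOn Real.log (Set.uIcc ρ 1) :=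
      Real.continuousOn_log.mono fun r hr => (hpos r hr).ne'
    have h2 : ∀ r ∈ Set.uIcc ρ 1, r ≠ 0 := fun r hr => (hpos r hr).ne'
    fun_prop (disch := assumption)

/-- Integration by parts against the equation: the difference of the integrands is the derivative of
`r^(m+2) F F'`, with `F` the profile, and `F` vanishes at both ends. -/
lemma integral_pow_mul_profileDeriv_sq (m : ℕ) {ω ρ : ℝ} (hρ : 0 < ρ) (hρ1 : ρ ≤ 1)
    (h : ω * Real.log ρ = -Real.pi) :
    ∫ r in ρ..1, r ^ (m + 2) * profileDeriv m ω r ^ 2 =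
      ((((m : ℝ) + 1) / 2) ^ 2 + ω ^ 2) * ∫ r in ρ..1, r ^ m * profile m ω r ^ 2 := by
  have hpos : ∀ r ∈ Set.uIcc ρ 1, 0 < r := fun r hr => by
    rw [Set.uIcc_of_le hρ1] at hr
    exact hρ.trans_le hr.1
  have hl1 : ContinuousOn Real.log (Set.uIcc ρ 1) :=
    Real.continuousOn_log.mono fun r hr => (hpos r hr).ne'
  have hne : ∀ r ∈ Set.uIcc ρ 1, r ≠ 0 := fun r hr => (hpos r hr).ne'
  have e1 : ∫ r in ρ..1, r ^ (m + 2) * profileDeriv m ω r ^ 2 =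
      ∫ r in ρ..1, (-(((m : ℝ) + 1) / 2) * Real.sin (ω * Real.log r)
        + ω * Real.cos (ω * Real.log r)) ^ 2 / r := by
    refine intervalIntegral.integral_congr fun r hr => ?_
    have hr0 := hpos r hr
    rw [profileDeriv_sq m ω hr0]
    field_simp
    ring
  rw [e1, intervalIntegral.integral_congr fun r hr => pow_mul_profile_sq m ω (hpos r hr),
    ← sub_eq_zero, ← intervalIntegral.integral_const_mul, ← intervalIntegral.integral_sub]
  · have hd : ∀ r ∈ Set.uIcc ρ 1, HasDerivAt (fun r =>
        -(((m : ℝ) + 1) / 2) * Real.sin (ω * Real.log r) ^ 2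
          + ω * (Real.cos (ω * Real.log r) * Real.sin (ω * Real.log r)))
        ((-(((m : ℝ) + 1) / 2) * Real.sin (ω * Real.log r)
          + ω * Real.cos (ω * Real.log r)) ^ 2 / r -
          ((((m : ℝ) + 1) / 2) ^ 2 + ω ^ 2) * (Real.sin (ω * Real.log r) ^ 2 / r)) r := by
      intro r hr
      have hr0 := hpos r hr
      have hl' := (Real.hasDerivAt_log hr0.ne').const_mul ω
      refine (((hl'.sin.pow 2).const_mul (-(((m : ℝ) + 1) / 2))).add
        ((hl'.cos.mul hl'.sin).const_mul ω)).congr_deriv ?_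
      push_cast
      field_simp
      ring
    rw [intervalIntegral.integral_eq_sub_of_hasDerivAt hd]
    · simp [h]
    · exact ContinuousOn.intervalIntegrable (by fun_prop (disch := assumption))
  · exact ContinuousOn.intervalIntegrable (by fun_prop (disch := assumption))
  · exact ContinuousOn.intervalIntegrable (by fun_prop (disch := assumption))

/-! ### Upper bound: interpolation on one element -/

/-- The weighted energy of the affine interpolant on one element is controlled by that of the
interpolated function. -/
lemma slope_energy_le (l : ℕ) {f f' : ℝ → ℝ} {p q : ℝ} (hp : 0 < p) (hpq : p < q)
    (hf : ∀ r ∈ Set.Icc p q, HasDerivAt f (f' r) r) (hf' : ContinuousOn f' (Set.Icc p q)) :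
    ∫ r in p..q, r ^ l * ((f q - f p) / (q - p)) ^ 2 ≤
      (q / p) ^ l * ∫ r in p..q, r ^ l * f' r ^ 2 := by
  set s := (f q - f p) / (q - p) with hs
  have hI : ∀ g : ℝ → ℝ, ContinuousOn g (Set.Icc p q) →
      IntervalIntegrable g MeasureTheory.volume p q :=
    fun g hg => hg.intervalIntegrable_of_Icc hpq.le
  have hsq : s * (q - p) = f q - f p := div_mul_cancel₀ _ (by linarith)
  have hftc : ∫ r in p..q, f' r = f q - f p :=
    intervalIntegral.integral_eq_sub_of_hasDerivAt (by rwa [Set.uIcc_of_le hpq.le]) (hI _ hf')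
  -- The slope `s` is the mean of `f'`; this is `(f' - s)² ≥ 0` integrated.
  have h1 : s ^ 2 * (q - p) ≤ ∫ r in p..q, f' r ^ 2 := by
    have h2 : ∫ r in p..q, (2 * s * f' r - s ^ 2) ≤ ∫ r in p..q, f' r ^ 2 :=
      intervalIntegral.integral_mono_on hpq.le (hI _ (by fun_prop)) (hI _ (by fun_prop))
        fun r _ => by nlinarith [sq_nonneg (f' r - s)]
    rw [intervalIntegral.integral_sub (hI _ (by fun_prop)) (hI _ (by fun_prop)),
      intervalIntegral.integral_const_mul, hftc, intervalIntegral.integral_const, smul_eq_mul,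
      ← hsq] at h2
    linarith
  have h3 : ∫ r in p..q, p ^ l * f' r ^ 2 ≤ ∫ r in p..q, r ^ l * f' r ^ 2 :=
    intervalIntegral.integral_mono_on hpq.le (hI _ (by fun_prop)) (hI _ (by fun_prop))
      fun r hr => by
        have := hr.1
        gcongr
  rw [intervalIntegral.integral_const_mul] at h3
  have h4 : ∫ r in p..q, r ^ l * s ^ 2 ≤ ∫ r in p..q, q ^ l * s ^ 2 :=
    intervalIntegral.integral_mono_on hpq.le (hI _ (by fun_prop)) (hI _ (by fun_prop))
      fun r hr => by
        have h0 : 0 ≤ r := hp.le.trans hr.1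
        have := hr.2
        gcongr
  rw [intervalIntegral.integral_const, smul_eq_mul] at h4
  have hq : 0 < q := hp.trans hpq
  calc _ ≤ (q - p) * (q ^ l * s ^ 2) := h4
    _ = (q / p) ^ l * (p ^ l * (s ^ 2 * (q - p))) := by
      have : q ^ l = (q / p) ^ l * p ^ l := by
        rw [div_pow, div_mul_cancel₀ _ (by positivity)]
      rw [this]
      ring
    _ ≤ (q / p) ^ l * (p ^ l * ∫ r in p..q, f' r ^ 2) := by gcongr
    _ ≤ _ := by gcongr

/-- The weighted mass of the affine interpolant on one element is bounded below by that of the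
interpolated function. -/
lemma le_interp_mass (l : ℕ) {f f' : ℝ → ℝ} {p q B ε : ℝ} (hp : 0 < p) (hpq : p < q)
    (hf : ∀ r ∈ Set.Icc p q, HasDerivAt f (f' r) r) (hB : ∀ r ∈ Set.Icc p q, |f' r| ≤ B)
    (hε : 0 < ε) :
    (1 - ε) * (∫ r in p..q, r ^ l * f r ^ 2) - (q - p) * (q ^ l * (2 * B * (q - p)) ^ 2 / ε) ≤
      ∫ r in p..q, r ^ l *
        (f p - (f q - f p) / (q - p) * p + (f q - f p) / (q - p) * r) ^ 2 := by
  have hB0 : 0 ≤ B := (abs_nonneg _).trans (hB p ⟨le_rfl, hpq.le⟩)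
  have hfc : ContinuousOn f (Set.Icc p q) := fun r hr => (hf r hr).continuousAt.continuousWithinAt
  have hI : ∀ g : ℝ → ℝ, ContinuousOn g (Set.Icc p q) →
      IntervalIntegrable g MeasureTheory.volume p q :=
    fun g hg => hg.intervalIntegrable_of_Icc hpq.le
  have hlip : ∀ r ∈ Set.Icc p q, |f r - f p| ≤ B * (r - p) := by
    intro r hr
    have := (convex_Icc p q).norm_image_sub_le_of_norm_hasDerivWithin_le
      (fun x hx => (hf x hx).hasDerivWithinAt) hB ⟨le_rfl, hpq.le⟩ hr
    rwa [Real.norm_eq_abs, Real.norm_eq_abs, abs_of_nonneg (sub_nonneg.2 hr.1)] at this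
  set s := (f q - f p) / (q - p) with hs
  have hsB : |s| ≤ B := by
    rw [hs, abs_div, abs_of_pos (sub_pos.2 hpq), div_le_iff₀ (sub_pos.2 hpq)]
    exact hlip q ⟨hpq.le, le_rfl⟩
  rw [← smul_eq_mul (q - p), ← intervalIntegral.integral_const,
    ← intervalIntegral.integral_const_mul,
    ← intervalIntegral.integral_sub (hI _ (by fun_prop)) (hI _ (by fun_prop))]
  refine intervalIntegral.integral_mono_on hpq.le (hI _ (by fun_prop)) (hI _ (by fun_prop))
    fun r hr => ?_
  have hr0 : 0 ≤ r := hp.le.trans hr.1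
  set b := f p - s * p + s * r with hb
  -- Both `f` and its interpolant stay within `B (q - p)` of the common value `f p`.
  have hdiff : |b - f r| ≤ 2 * B * (q - p) := by
    have e : b - f r = s * (r - p) - (f r - f p) := by
      rw [hb]
      ring
    rw [e]
    refine (abs_sub _ _).trans ?_
    rw [abs_mul, abs_of_nonneg (sub_nonneg.2 hr.1)]
    have h1 : |s| * (r - p) ≤ B * (r - p) :=
      mul_le_mul_of_nonneg_right hsB (sub_nonneg.2 hr.1)
    have h2 : B * (r - p) ≤ B * (q - p) := mul_le_mul_of_nonneg_left (by linarith [hr.2]) hB0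
    linarith [hlip r hr]
  have hsq : (b - f r) ^ 2 ≤ (2 * B * (q - p)) ^ 2 := by
    rw [← sq_abs (b - f r)]
    exact pow_le_pow_left₀ (abs_nonneg _) hdiff 2
  have hyoung : (1 - ε) * f r ^ 2 - (b - f r) ^ 2 / ε ≤ b ^ 2 := by
    have h1 : 0 ≤ (ε * f r + (b - f r)) ^ 2 / ε := by positivity
    have h2 : (ε * f r + (b - f r)) ^ 2 / ε =
        ε * f r ^ 2 + 2 * f r * (b - f r) + (b - f r) ^ 2 / ε := by
      field_simp
      ring
    nlinarith [sq_nonneg (b - f r)]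
  have hlast : r ^ l * ((b - f r) ^ 2 / ε) ≤ q ^ l * (2 * B * (q - p)) ^ 2 / ε := by
    rw [mul_div_assoc]
    have := hr.2
    have hq0 : 0 ≤ q := hr0.trans this
    gcongr
  have hfin := mul_le_mul_of_nonneg_left hyoung (pow_nonneg hr0 l)
  nlinarith

/-! ### Upper bound on the mesh -/

namespace Mesh

lemma mass_eq_zero (M : Mesh) (p : ℕ) {u : ℕ → ℝ} (hu : ∀ j ≤ M.N, u j = 0) :
    M.mass p u = 0 := by
  refine Finset.sum_eq_zero fun i hi => ?_
  have hi := Finset.mem_range.1 hi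
  simp [icpt, slope, hu i hi.le, hu (i + 1) hi]

/-- For a target between the size of the mesh and `1` there is a node just above it. -/
lemma exists_node_near (M : Mesh) {t : ℝ} (ht0 : 0 < t) (ht1 : t ≤ 1) :
    ∃ j, 0 < j ∧ j ≤ M.N ∧ t ≤ M.node j ∧ M.node j ≤ t + M.size := by
  classical
  have hex : ∃ j, t ≤ M.node j := ⟨M.N, by rwa [M.node_N]⟩
  have hle : Nat.find hex ≤ M.N := Nat.find_min' hex (by rwa [M.node_N])
  have hpos : 0 < Nat.find hex := by
    rcases Nat.eq_zero_or_pos (Nat.find hex) with h | h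
    · have h1 := Nat.find_spec hex
      rw [h, M.node_zero] at h1
      linarith
    · exact h
  refine ⟨Nat.find hex, hpos, hle, Nat.find_spec hex, ?_⟩
  have h1 := not_le.1 (Nat.find_min hex (Nat.sub_lt hpos one_pos))
  have h2 := M.sub_le_size (i := Nat.find hex - 1) (by omega)
  rw [Nat.sub_add_cancel (by omega : 1 ≤ Nat.find hex)] at h2
  linarith

/-- Interpolating `profile` on `[node j₀, 1]` bounds the discrete Hardy constant from above. -/
lemma discreteHardyConst_le_of_node (M : Mesh) (m : ℕ) {y : ℝ} (hy0 : 0 < y) (hy1 : y ≤ 1)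
    (hh : M.size = y ^ 10) {j₀ : ℕ} (hj0 : 0 < j₀) (hjN : j₀ ≤ M.N) (hρ : y ^ 6 ≤ M.node j₀)
    (hlog : 1 ≤ -Real.log (M.node j₀))
    (hsmall : (1 + 2 * (4 * 2 ^ m * (((m : ℝ) + 1) / 2 + Real.pi) ^ 2)) * y < 1) :
    discreteHardyConst (m + 3) M ≤
      (1 + y ^ 4) ^ (m + 2) / (1 - (1 + 2 * (4 * 2 ^ m * (((m : ℝ) + 1) / 2 + Real.pi) ^ 2)) * y) *
        ((((m : ℝ) + 1) / 2) ^ 2 + (Real.pi / -Real.log (M.node j₀)) ^ 2) := by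
  set ρ := M.node j₀ with hρdef
  set K : ℝ := 4 * 2 ^ m * (((m : ℝ) + 1) / 2 + Real.pi) ^ 2 with hK
  set ω := Real.pi / -Real.log ρ with hω
  set F := profile m ω with hF
  have hρ0 : 0 < ρ := M.node_pos hj0 hjN
  have hρ1 : ρ ≤ 1 := M.node_le_one hjN
  have hω0 : 0 < ω := div_pos Real.pi_pos (by linarith)
  have hωπ : ω ≤ Real.pi := div_le_self Real.pi_pos.le hlog
  have hωρ : ω * Real.log ρ = -Real.pi := by
    rw [hω]
    have : Real.log ρ ≠ 0 := by linarith
    field_simp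
  -- The profile vanishes at `ρ`, so the cutoff agrees with it at `j₀` and creates no transition
  -- element.
  set u : ℕ → ℝ := fun i => if i < j₀ then 0 else F (M.node i) with hu
  have hu0 : ∀ i ≤ j₀, u i = 0 := by
    intro i hi
    rcases hi.lt_or_eq with h | h
    · simp [hu, h]
    · simp [hu, h, hF, profile, ← hρdef, hωρ]
  have huF : ∀ i, j₀ ≤ i → u i = F (M.node i) := fun i hi => by simp [hu, not_lt.2 hi]
  have huN : u M.N = 0 := by
    rw [huF _ hjN, M.node_N]
    simp [hF, profile]
  have hlt : ∀ i ∈ Finset.Ico j₀ M.N, M.node i < M.node (i + 1) := fun i hi =>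
    M.node_lt (Nat.lt_succ_self i) (Finset.mem_Ico.1 hi).2
  have hge : ∀ i ∈ Finset.Ico j₀ M.N, ρ ≤ M.node i := fun i hi =>
    M.node_mono (Finset.mem_Ico.1 hi).1
  have hder : ∀ i ∈ Finset.Ico j₀ M.N, ∀ r ∈ Set.Icc (M.node i) (M.node (i + 1)),
      HasDerivAt F (profileDeriv m ω r) r := fun i hi r hr =>
    hasDerivAt_profile m ω (hρ0.trans_le ((hge i hi).trans hr.1))
  -- Elements have length at most `y ^ 10` and lie above `y ^ 6`, so their relative length is at
  -- most `y ^ 4`.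
  have hstep : ∀ i ∈ Finset.Ico j₀ M.N, M.node (i + 1) ≤ (1 + y ^ 4) * M.node i := by
    intro i hi
    have h1 := M.sub_le_size (Finset.mem_Ico.1 hi).2
    have h2 : y ^ 10 ≤ y ^ 4 * M.node i := by
      calc y ^ 10 = y ^ 4 * y ^ 6 := by ring
        _ ≤ _ := by
          gcongr
          exact hρ.trans (hge i hi)
    rw [hh] at h1
    linarith
  have hE : M.energy (m + 2) u ≤ (1 + y ^ 4) ^ (m + 2) *
      ∫ r in ρ..1, r ^ (m + 2) * profileDeriv m ω r ^ 2 := by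
    have hc : ∀ i ∈ Finset.Ico j₀ M.N,
        ContinuousOn (profileDeriv m ω) (Set.Icc (M.node i) (M.node (i + 1))) := fun i hi =>
      continuousOn_profileDeriv m ω (hρ0.trans_le (hge i hi))
    rw [← M.node_N, hρdef, ← intervalIntegral.sum_integral_adjacent_intervals_Ico hjN,
      energy, ← Finset.sum_range_add_sum_Ico _ hjN, Finset.mul_sum]
    · rw [Finset.sum_eq_zero, zero_add]
      · refine Finset.sum_le_sum fun i hi => ?_
        have hi0 := hρ0.trans_le (hge i hi)
        have h := slope_energy_le (m + 2) hi0 (hlt i hi) (hder i hi) (hc i hi)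
        have hi' := (Finset.mem_Ico.1 hi).1
        rw [slope, huF i hi', huF (i + 1) (by omega)]
        refine h.trans (mul_le_mul_of_nonneg_right (pow_le_pow_left₀ ?_ ?_ _) ?_)
        · exact div_nonneg (M.node_nonneg _) (M.node_nonneg _)
        · rw [div_le_iff₀ hi0]
          rw [M.node_N]
          exact hstep i hi
        · refine intervalIntegral.integral_nonneg (hlt i hi).le fun r hr => ?_
          have : 0 ≤ r := hi0.le.trans hr.1
          positivity
      · intro i hi
        have hi := Finset.mem_range.1 hi
        simp [slope, hu0 i hi.le, hu0 (i + 1) hi]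
    · intro i hi
      have hi' : i ∈ Finset.Ico j₀ M.N := Finset.mem_Ico.2 hi
      have := hc i hi'
      exact ContinuousOn.intervalIntegrable_of_Icc (hlt i hi').le (by fun_prop)
  have hM : (1 - y) * (∫ r in ρ..1, r ^ m * F r ^ 2) - K * y ≤ M.mass m u := by
    have hel : ∀ i ∈ Finset.Ico j₀ M.N,
        (1 - y) * (∫ r in M.node i..M.node (i + 1), r ^ m * F r ^ 2)
          - K * y * (M.node (i + 1) - M.node i) ≤
        ∫ r in M.node i..M.node (i + 1), r ^ m * (M.icpt u i + M.slope u i * r) ^ 2 := by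
      intro i hi
      have hi0 := hρ0.trans_le (hge i hi)
      have hi' := (Finset.mem_Ico.1 hi).1
      -- The Young parameter is `ε = y`. In the error, the squared diameter gives `y ^ 20`, the
      -- bound on `F'` leaves three inverse powers of the node, at most `y ^ (-18)`, and `1 / ε`
      -- costs one more `y`; the net factor is `y`.
      have h := le_interp_mass m hi0 (hlt i hi) (hder i hi)
        (fun r hr => abs_profileDeriv_le m hω0.le hi0 hr.1) hy0
      rw [icpt, slope, huF i hi', huF (i + 1) (by omega)]
      refine le_trans ?_ h
      have hd0 : 0 ≤ M.node (i + 1) - M.node i := sub_nonneg.2 (hlt i hi).le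
      have hd1 : M.node (i + 1) - M.node i ≤ y ^ 10 := hh ▸ M.sub_le_size (Finset.mem_Ico.1 hi).2
      have hq2 : M.node (i + 1) ≤ 2 * M.node i := by
        have h1 := hstep i hi
        have h2 : y ^ 4 ≤ 1 := pow_le_one₀ hy0.le hy1
        nlinarith
      have hq0 := M.node_nonneg (i + 1)
      have hb : M.node (i + 1) ^ m * (2 * Real.sqrt ((((m : ℝ) + 1) / 2 + ω) ^ 2 /
          M.node i ^ (m + 3)) * (M.node (i + 1) - M.node i)) ^ 2 / y ≤ K * y := by
        rw [div_le_iff₀ hy0, mul_pow, mul_pow, Real.sq_sqrt (by positivity)]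
        have hp6 : y ^ 6 ≤ M.node i := hρ.trans (hge i hi)
        have hp18 : y ^ 18 ≤ M.node i ^ 3 := by
          calc y ^ 18 = (y ^ 6) ^ 3 := by ring
            _ ≤ _ := by gcongr
        calc _ ≤ (2 * M.node i) ^ m * (2 ^ 2 * ((((m : ℝ) + 1) / 2 + Real.pi) ^ 2 /
              M.node i ^ (m + 3)) * (y ^ 10) ^ 2) := by gcongr
          _ = K * y ^ 2 * (y ^ 18 / M.node i ^ 3) := by
            rw [hK, mul_pow, pow_add (M.node i) m 3]
            field_simp
            ring
          _ ≤ K * y ^ 2 * 1 := by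
            gcongr
            exact div_le_one_of_le₀ hp18 (by positivity)
          _ = _ := by ring
      have := mul_le_mul_of_nonneg_left hb hd0
      linarith
    have hsum := Finset.sum_le_sum hel
    have hFc : ∀ k ∈ Set.Ico j₀ M.N, IntervalIntegrable (fun r => r ^ m * F r ^ 2)
        MeasureTheory.volume (M.node k) (M.node (k + 1)) := by
      intro i hi
      have hi' : i ∈ Finset.Ico j₀ M.N := Finset.mem_Ico.2 hi
      have : ContinuousOn F (Set.Icc (M.node i) (M.node (i + 1))) := fun r hr =>
        (hder i hi' r hr).continuousAt.continuousWithinAt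
      exact ContinuousOn.intervalIntegrable_of_Icc (hlt i hi').le (by fun_prop)
    rw [Finset.sum_sub_distrib, ← Finset.mul_sum, ← Finset.mul_sum,
      intervalIntegral.sum_integral_adjacent_intervals_Ico hjN hFc, Finset.sum_Ico_sub _ hjN,
      ← hρdef, M.node_N] at hsum
    have hpart : ∑ i ∈ Finset.Ico j₀ M.N,
        ∫ r in M.node i..M.node (i + 1), r ^ m * (M.icpt u i + M.slope u i * r) ^ 2
        ≤ M.mass m u := by
      rw [mass, ← Finset.sum_range_add_sum_Ico _ hjN]
      refine le_add_of_nonneg_left (Finset.sum_nonneg fun i _ =>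
        intervalIntegral.integral_nonneg (M.node_mono (Nat.le_succ i)) fun r hr => ?_)
      have := le_trans (M.node_nonneg i) hr.1
      positivity
    have hKy : 0 ≤ K * y * ρ := by positivity
    linarith
  rw [integral_pow_mul_profileDeriv_sq m hρ0 hρ1 hωρ] at hE
  have hI := integral_pow_mul_profile_sq m hω0 hρ0 hρ1 hωρ
  rw [← hF] at hE hI
  rw [hI] at hE hM
  set I := -Real.log ρ / 2 with hIdef
  have hI2 : 1 / 2 ≤ I := by
    rw [hIdef]
    linarith
  have hK0 : 0 ≤ K := by positivity
  -- The absolute error `K y` becomes relative because `I ≥ 1 / 2`.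
  have hM2 : (1 - (1 + 2 * K) * y) * I ≤ M.mass m u := by
    have : K * y ≤ 2 * K * y * I := by nlinarith [mul_nonneg hK0 hy0.le]
    linarith
  have hden : 0 < 1 - (1 + 2 * K) * y := by linarith
  have hmpos : 0 < M.mass m u := lt_of_lt_of_le (by positivity) hM2
  obtain ⟨j, hjN', huj⟩ : ∃ j ≤ M.N, u j ≠ 0 := by
    by_contra! hcon
    exact hmpos.ne' (M.mass_eq_zero m hcon)
  refine ((M.isLeast_discreteHardyConst (m + 3)).2
    (M.interp_mem_values (m + 3) huN hjN' huj)).trans ?_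
  rw [show m + 3 - 1 = m + 2 from rfl, show m + 3 - 3 = m from rfl, div_le_iff₀ hmpos]
  refine hE.trans ?_
  calc _ = (1 + y ^ 4) ^ (m + 2) / (1 - (1 + 2 * K) * y) * ((((m : ℝ) + 1) / 2) ^ 2 + ω ^ 2) *
        ((1 - (1 + 2 * K) * y) * I) := by
          rw [div_mul_eq_mul_div, div_mul_eq_mul_div, eq_div_iff hden.ne']
          ring
    _ ≤ _ := by gcongr

/-- Upper bound of the discrete Hardy constant in terms of the size of the mesh. -/
lemma discreteHardyConst_le (M : Mesh) (m : ℕ) {y : ℝ} (hy0 : 0 < y) (hy1 : y ≤ 1 / 2)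
    (hh : M.size = y ^ 10)
    (hsmall : (1 + 2 * (4 * 2 ^ m * (((m : ℝ) + 1) / 2 + Real.pi) ^ 2)) * y < 1) :
    discreteHardyConst (m + 3) M ≤
      (1 + y ^ 4) ^ (m + 2) / (1 - (1 + 2 * (4 * 2 ^ m * (((m : ℝ) + 1) / 2 + Real.pi) ^ 2)) * y) *
        ((((m : ℝ) + 1) / 2) ^ 2 + 4 * Real.pi ^ 2 / |Real.log M.size| ^ 2) := by
  -- The node found lies between `y ^ 6` and `y ^ 6 + y ^ 10 ≤ y ^ 5 = √h`, so `-log ρ` is at least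
  -- half of `|log h|`; this gives the factor `4`.
  obtain ⟨j, hj0, hjN, hρ, hρ'⟩ := M.exists_node_near (t := y ^ 6) (by positivity)
    (pow_le_one₀ hy0.le (by linarith))
  have hρ5 : M.node j ≤ y ^ 5 := by
    have h1 : y ^ 5 ≤ (1 / 2) ^ 5 := by gcongr
    have h2 : y + y ^ 5 ≤ 1 := by norm_num at h1 ⊢; linarith
    calc M.node j ≤ y ^ 6 + y ^ 10 := hh ▸ hρ'
      _ = y ^ 5 * (y + y ^ 5) := by ring
      _ ≤ y ^ 5 * 1 := by gcongr
      _ = _ := mul_one _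
  have hlogρ : Real.log (M.node j) ≤ 5 * Real.log y := by
    have := Real.log_le_log (M.node_pos hj0 hjN) hρ5
    rwa [Real.log_pow] at this
  have hlogy : Real.log y ≤ -Real.log 2 := by
    have := Real.log_le_log hy0 hy1
    rwa [one_div, Real.log_inv] at this
  have hl2 := Real.log_two_gt_d9
  have hlog1 : 1 ≤ -Real.log (M.node j) := by linarith
  refine (M.discreteHardyConst_le_of_node m hy0 (by linarith) hh hj0 hjN hρ hlog1 hsmall).trans ?_
  have hden : 0 < 1 - (1 + 2 * (4 * 2 ^ m * (((m : ℝ) + 1) / 2 + Real.pi) ^ 2)) * y := by linarith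
  have hsq : (Real.pi / -Real.log (M.node j)) ^ 2 ≤ 4 * Real.pi ^ 2 / |Real.log M.size| ^ 2 := by
    have hls : |Real.log M.size| = 2 * (-(5 * Real.log y)) := by
      rw [hh, Real.log_pow, abs_of_nonpos (by push_cast; linarith)]
      push_cast
      ring
    rw [hls]
    calc (Real.pi / -Real.log (M.node j)) ^ 2 ≤ (Real.pi / (-(5 * Real.log y))) ^ 2 := by
          have := Real.pi_pos
          have h5 : 0 < -(5 * Real.log y) := by linarith
          gcongr
      _ = _ := by
        have : Real.log y ≠ 0 := by linarith
        field_simp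
        ring
  gcongr

/-- Lower bound of the discrete Hardy constant in terms of the size of the mesh. -/
lemma le_discreteHardyConst_of_isUniform (M : Mesh) (m : ℕ) {σ : ℝ} (hM : M.IsUniform σ) :
    (((m : ℝ) + 1) / 2) ^ 2 +
      Real.pi ^ 2 / (|Real.log M.size| + (256 * ((m : ℝ) + 2) / 3 + |Real.log σ|)) ^ 2 ≤
      discreteHardyConst (m + 3) M := by
  refine le_trans ?_ (M.le_discreteHardyConst m)
  have hx0 : 0 < M.node 1 := M.node_pos one_pos M.N_pos
  have hx1 : Real.log (M.node 1) ≤ 0 := Real.log_nonpos hx0.le (M.node_le_one M.N_pos)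
  -- Uniformity on the first element is `h / x₁ ≤ σ`, whence `-log x₁ ≤ |log h| + |log σ|`.
  have h := hM ⟨0, M.N_pos⟩
  rw [M.diam_eq M.N_pos, M.node_zero, zero_add, sub_zero] at h
  have h0 : 0 < M.size / M.node 1 := div_pos M.size_pos hx0
  have h1 := Real.log_le_log h0 h
  rw [Real.log_div M.size_pos.ne' hx0.ne'] at h1
  have h2 := le_abs_self (Real.log σ)
  have h3 := neg_le_abs (Real.log M.size)
  have hpos : 0 < 256 * ((m : ℝ) + 2) / 3 - Real.log (M.node 1) := by
    have : (0 : ℝ) < 256 * ((m : ℝ) + 2) / 3 := by positivity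
    linarith
  gcongr
  linarith

end Mesh

/-! ### Error terms and conclusion -/

lemma tendsto_abs_log_nhdsGT_zero : Tendsto (fun h : ℝ => |Real.log h|) (𝓝[>] 0) atTop :=
  tendsto_abs_atBot_atTop.comp Real.tendsto_log_nhdsGT_zero

lemma isLittleO_pi_sq_div_sub (C : ℝ) :
    (fun h : ℝ => Real.pi ^ 2 / (|Real.log h| + C) ^ 2 - Real.pi ^ 2 / |Real.log h| ^ 2)
      =o[𝓝[>] 0] (fun h : ℝ => 1 / |Real.log h| ^ 2) := by
  have ht := tendsto_abs_log_nhdsGT_zero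
  have hne : ∀ᶠ h : ℝ in 𝓝[>] 0, 0 < |Real.log h| ∧ 0 < |Real.log h| + C := by
    filter_upwards [ht.eventually_gt_atTop 0, ht.eventually_gt_atTop (-C)] with h h1 h2
    exact ⟨h1, by linarith⟩
  rw [isLittleO_iff_tendsto']
  · have h1 : Tendsto (fun h : ℝ => Real.pi ^ 2 / (1 + C / |Real.log h|) ^ 2 - Real.pi ^ 2)
        (𝓝[>] 0) (𝓝 (Real.pi ^ 2 / (1 + 0) ^ 2 - Real.pi ^ 2)) :=
      (tendsto_const_nhds.div ((tendsto_const_nhds.add (ht.const_div_atTop C)).pow 2)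
        (by norm_num)).sub tendsto_const_nhds
    simp only [add_zero, one_pow, div_one, sub_self] at h1
    refine h1.congr' ?_
    filter_upwards [hne] with h ⟨ha, hb⟩
    have : 1 + C / |Real.log h| = (|Real.log h| + C) / |Real.log h| := by field_simp
    rw [this]
    field_simp
  · filter_upwards [hne] with h ⟨ha, _⟩ h0
    exact absurd h0 (by positivity)

/-- The first factor is a function of `y = h^(1/10)`, differentiable at `0` with value `0` there,
hence `O(h^(1/10))`. This beats every power of the logarithm, and the second factor is bounded. -/
lemma isLittleO_upper_error (l : ℕ) (A k c : ℝ) :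
    (fun h : ℝ => ((1 + (h ^ (1 / 10 : ℝ)) ^ 4) ^ l / (1 - A * h ^ (1 / 10 : ℝ)) - 1) *
      (k + c / |Real.log h| ^ 2)) =o[𝓝[>] 0] (fun h : ℝ => 1 / |Real.log h| ^ 2) := by
  have hy : Tendsto (fun h : ℝ => h ^ (1 / 10 : ℝ)) (𝓝[>] 0) (𝓝 0) := by
    have := (Real.continuousAt_rpow_const 0 (1 / 10 : ℝ) (Or.inr (by norm_num))).tendsto
    rw [Real.zero_rpow (by norm_num)] at this
    exact this.mono_left nhdsWithin_le_nhds
  have hg : DifferentiableAt ℝ (fun y : ℝ => (1 + y ^ 4) ^ l / (1 - A * y)) 0 := by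
    refine DifferentiableAt.div (by fun_prop) (by fun_prop) (by simp)
  have h1 := hg.hasDerivAt.isBigO_sub
  have h2 : (fun h : ℝ => (1 + (h ^ (1 / 10 : ℝ)) ^ 4) ^ l / (1 - A * h ^ (1 / 10 : ℝ)) - 1)
      =O[𝓝[>] 0] fun h : ℝ => h ^ (1 / 10 : ℝ) := by
    have := h1.comp_tendsto hy
    simpa [Function.comp_def] using this
  have h3 : (fun h : ℝ => h ^ (1 / 10 : ℝ)) =o[𝓝[>] 0] (fun h : ℝ => 1 / |Real.log h| ^ 2) := by
    have h4 := (isLittleO_abs_log_rpow_rpow_nhdsGT_zero 2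
      (by norm_num : (-(1 / 10) : ℝ) < 0)).inv_rev ?_
    · refine h4.congr' ?_ ?_
      · filter_upwards [self_mem_nhdsWithin] with h hh
        rw [Real.rpow_neg (le_of_lt hh), inv_inv]
      · filter_upwards with h
        rw [one_div, Real.rpow_two]
    · filter_upwards [tendsto_abs_log_nhdsGT_zero.eventually_gt_atTop 0] with h hh h0
      exact absurd h0 (by positivity)
  have h5 : (fun h : ℝ => k + c / |Real.log h| ^ 2) =O[𝓝[>] 0] fun _ => (1 : ℝ) := by
    have ht := (tendsto_pow_atTop (two_ne_zero)).comp tendsto_abs_log_nhdsGT_zero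
    exact (tendsto_const_nhds.add (ht.const_div_atTop c)).isBigO_one ℝ
  simpa using (h2.trans_isLittleO h3).mul_isBigO h5

theorem theorem1p2 (n : ℕ) (hn : 3 ≤ n) (σ : ℝ) :
    ∃ e₁ e₂ : ℝ → ℝ,
      e₁ =o[𝓝[>] 0] (fun h : ℝ => 1 / |Real.log h| ^ 2) ∧
      e₂ =o[𝓝[>] 0] (fun h : ℝ => 1 / |Real.log h| ^ 2) ∧
      ∃ h₀ : ℝ, 0 < h₀ ∧ ∀ M : Mesh, M.size ≤ h₀ → M.IsUniform σ →
        IsLeast (discreteHardyValues n M) (discreteHardyConst n M) ∧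
        hardyConst n + Real.pi ^ 2 / |Real.log M.size| ^ 2 + e₁ M.size ≤ discreteHardyConst n M ∧
        discreteHardyConst n M ≤
          hardyConst n + ((n : ℝ) + 1) ^ 2 * Real.pi ^ 2 / (4 * |Real.log M.size| ^ 2)
            + e₂ M.size := by
  obtain ⟨m, rfl⟩ : ∃ m, n = m + 3 := ⟨n - 3, by omega⟩
  have hS : hardyConst (m + 3) = (((m : ℝ) + 1) / 2) ^ 2 := by
    rw [hardyConst]
    push_cast
    ring
  set A : ℝ := 1 + 2 * (4 * 2 ^ m * (((m : ℝ) + 1) / 2 + Real.pi) ^ 2) with hA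
  have hA1 : 1 ≤ A := by
    rw [hA]
    have : 0 ≤ 2 * (4 * 2 ^ m * (((m : ℝ) + 1) / 2 + Real.pi) ^ 2) := by positivity
    linarith
  -- The error functions are the exact differences between the explicit bounds and the main terms,
  -- with `4 π²` in the upper one. The threshold ensures `A y ≤ 1 / 2` for `y = h^(1/10)`, and `y ≤
  -- 1 / 2` since `A ≥ 1`.
  refine ⟨_, _, isLittleO_pi_sq_div_sub (256 * ((m : ℝ) + 2) / 3 + |Real.log σ|),
    isLittleO_upper_error (m + 2) A ((((m : ℝ) + 1) / 2) ^ 2) (4 * Real.pi ^ 2),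
    (1 / (2 * A)) ^ 10, by positivity, fun M hM hσ => ⟨M.isLeast_discreteHardyConst _, ?_, ?_⟩⟩
  · have := M.le_discreteHardyConst_of_isUniform m hσ
    rw [hS]
    linarith
  · set y := M.size ^ (1 / 10 : ℝ) with hy
    have hy0 : 0 < y := Real.rpow_pos_of_pos M.size_pos _
    have hh : M.size = y ^ 10 := by
      rw [hy, ← Real.rpow_natCast, ← Real.rpow_mul M.size_pos.le]
      norm_num
    have hyA : y ≤ 1 / (2 * A) := by
      rw [hh] at hM
      exact le_of_pow_le_pow_left₀ (by norm_num) (by positivity) hM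
    have hyA' : A * y ≤ 1 / 2 := by
      calc A * y ≤ A * (1 / (2 * A)) := by gcongr
        _ = 1 / 2 := by field_simp
    have h := M.discreteHardyConst_le m hy0 (by nlinarith) hh (by rw [← hA]; linarith)
    rw [← hA] at h
    -- The factor `4` is `(n + 1)² / 4` at `n = 3` and is smaller than it for larger `n`.
    have hcmp : 4 * Real.pi ^ 2 / |Real.log M.size| ^ 2 ≤
        (((m + 3 : ℕ) : ℝ) + 1) ^ 2 * Real.pi ^ 2 / (4 * |Real.log M.size| ^ 2) := by
      have h16 : 16 ≤ (((m + 3 : ℕ) : ℝ) + 1) ^ 2 := by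
        push_cast
        nlinarith [Nat.cast_nonneg (α := ℝ) m]
      calc 4 * Real.pi ^ 2 / |Real.log M.size| ^ 2
          = 16 * Real.pi ^ 2 / (4 * |Real.log M.size| ^ 2) := by
            rw [show 16 * Real.pi ^ 2 = 4 * (4 * Real.pi ^ 2) by ring,
              mul_div_mul_left _ _ (by norm_num)]
        _ ≤ _ := by gcongr
    rw [hS]
    linarith
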